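/- Let $p\in\mathbb{N}$, $l>0$, and let $D=\mathrm{diag}\{d_1,\dots,d_p\}$ with $d_1,\dots,d_p>0$. Let $L^2_p(0,l)$ be the Hilbert space of square integrable $\mathbb{C}^p$-valued functions on $(0,l)$, and let $A$ be the bounded operator $(Af)(x)=iD\int_0^x f(t)\,dt$ on $L^2_p(0,l)$, with adjoint $A^*$. A bounded operator $S$ on $L^2_p(0,l)$ is called an operator with $D$-difference kernel $s(x,t)=\{s_{ij}(x,t)\}_{i,j=1}^p$ if $s_{ij}(x,t)=s_{ij}(d_ix-d_jt)$ for functions $s_{ij}\in L^2(-d_jl,d_il)$ of one variable, and, for all $f\in L^2_p(0,l)$, $$Sf=\frac{d}{dx}\int_0^l s(x,t)f(t)\,dt ,$$ meaning that the integral is an absolutely continuous function of $x\in[0,l]$ whose derivative is $(Sf)(x)$ for almost every $x$. Theorem. Let $S$ be a bounded operator on $L^2_p(0,l)$ which satisfies the operator identity $$(AS-SA^*)f=i\int_0^l\big(\Phi_1(x)+\widehat\Phi_1(t)\big)f(t)\,dt\qquad(f\in L^2_p(0,l)),$$ where $\Phi_1$ and $\widehat\Phi_1$ are $p\times p$ matrix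 functions with entries from $L^2(0,l)$. Then $S$ is an operator with a $D$-difference kernel: there is such a kernel $s(x,t)$ for $S$ with $$s(u,0)=D^{-1}\Phi_1(u),\qquad s(0,u)=-D^{-1}\widehat\Phi_1(u)$$ for almost every $u\in(0,l)$. Moreover, if $\widehat\Phi_1(t)=\Phi_1(t)^*$ for almost every $t\in(0,l)$, then for this kernel $$s(x,t)=-D^{-1}s(t,x)^*D$$ for almost every $(x,t)\in(0,l)^2$, and $S=S^*$. -/

import Mathlib

open MeasureTheory Set
open scoped Matrix

noncomputable section

namespace DDiff

/-- The Hilbert space `L²_p(0,l)` of square integrable `ℂ^p`-valued functions on `(0,l)`. -/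
abbrev L2 (p : ℕ) (l : ℝ) : Type :=
  Lp (EuclideanSpace ℂ (Fin p)) 2 (volume.restrict (Ioo (0 : ℝ) l))

/-- The diagonal matrix `D = diag{d₁, …, d_p}`. -/
def diagD {p : ℕ} (d : Fin p → ℝ) : Matrix (Fin p) (Fin p) ℂ :=
  Matrix.diagonal fun i => (d i : ℂ)

/-- The (standard) action of a `p × p` matrix on `ℂ^p` as a continuous linear map. -/
abbrev act {p : ℕ} (M : Matrix (Fin p) (Fin p) ℂ) :
    EuclideanSpace ℂ (Fin p) →L[ℂ] EuclideanSpace ℂ (Fin p) :=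
  Matrix.toEuclideanCLM (𝕜 := ℂ) M

/-- All entries of a matrix function belong to `L²(0,l)`. -/
def EntriesL2 {p : ℕ} (l : ℝ) (Φ : ℝ → Matrix (Fin p) (Fin p) ℂ) : Prop :=
  ∀ i j, MemLp (fun x => Φ x i j) 2 (volume.restrict (Ioo (0 : ℝ) l))

/-- The function `x ↦ i D ∫₀ˣ f(t) dt`. -/
def volterraFun {p : ℕ} (d : Fin p → ℝ) (f : ℝ → EuclideanSpace ℂ (Fin p)) (x : ℝ) :
    EuclideanSpace ℂ (Fin p) :=
  Complex.I • act (diagD d) (∫ t in (0 : ℝ)..x, f t)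

theorem integrableOn_of_L2 {p : ℕ} {l : ℝ} (f : L2 p l) :
    IntegrableOn f (Ioo (0 : ℝ) l) :=
  (Lp.memLp f).integrable (by norm_num)

theorem intervalIntegrable_of_L2 {p : ℕ} {l x : ℝ} (f : L2 p l) (hx : x ∈ Ioo (0 : ℝ) l) :
    IntervalIntegrable f volume 0 x :=
  (intervalIntegrable_iff_integrableOn_Ioc_of_le hx.1.le).2
    ((integrableOn_of_L2 f).mono_set fun _ ht => ⟨ht.1, ht.2.trans_lt hx.2⟩)

theorem integral_norm_le_of_L2 {p : ℕ} {l : ℝ} (f : L2 p l) :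
    ∫ t in Ioo (0 : ℝ) l, ‖f t‖ ≤
      ‖f‖ * ((volume.restrict (Ioo (0 : ℝ) l)) univ ^ (1 / 2 : ℝ)).toReal := by
  have h := eLpNorm_le_eLpNorm_mul_rpow_measure_univ (p := 1) (q := 2) (by norm_num)
    (Lp.memLp f).aestronglyMeasurable
  have h2 : (1 / (1 : ENNReal).toReal - 1 / (2 : ENNReal).toReal) = (1 / 2 : ℝ) := by norm_num
  rw [h2] at h
  rw [integral_norm_eq_lintegral_enorm (Lp.memLp f).aestronglyMeasurable,
    ← eLpNorm_one_eq_lintegral_enorm, Lp.norm_def, ← ENNReal.toReal_mul]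
  refine ENNReal.toReal_mono (ENNReal.mul_ne_top (Lp.eLpNorm_ne_top f) ?_) h
  exact ENNReal.rpow_ne_top_of_nonneg (by norm_num) (measure_ne_top _ _)

theorem norm_volterraFun_le {p : ℕ} {l x : ℝ} (d : Fin p → ℝ) (f : L2 p l)
    (hx : x ∈ Ioo (0 : ℝ) l) :
    ‖volterraFun d f x‖ ≤ ‖act (diagD d)‖ *
      (‖f‖ * ((volume.restrict (Ioo (0 : ℝ) l)) univ ^ (1 / 2 : ℝ)).toReal) := by
  rw [volterraFun, norm_smul, Complex.norm_I, one_mul]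
  refine ((act (diagD d)).le_opNorm _).trans ?_
  refine mul_le_mul_of_nonneg_left ?_ (norm_nonneg _)
  refine le_trans ?_ (integral_norm_le_of_L2 f)
  rw [intervalIntegral.integral_of_le hx.1.le]
  refine (norm_integral_le_integral_norm _).trans ?_
  exact setIntegral_mono_set (integrableOn_of_L2 f).norm (ae_of_all _ fun _ => norm_nonneg _)
    (Filter.Eventually.of_forall fun _ ht => ⟨ht.1, ht.2.trans_lt hx.2⟩)

theorem memLp_volterraFun {p : ℕ} {l : ℝ} (d : Fin p → ℝ) (f : L2 p l) :
    MemLp (volterraFun d f) 2 (volume.restrict (Ioo (0 : ℝ) l)) := by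
  refine MemLp.of_bound ?_ _ ((ae_restrict_mem measurableSet_Ioo).mono fun x hx =>
    norm_volterraFun_le d f hx)
  rcases le_or_gt l 0 with hl | hl
  · simp [Ioo_eq_empty_of_le hl]
  · have hc : ContinuousOn (fun x => ∫ t in (0 : ℝ)..x, f t) (Icc 0 l) := by
      rw [← uIcc_of_le hl.le]
      refine intervalIntegral.continuousOn_primitive_interval ?_
      rw [uIcc_of_le hl.le, integrableOn_Icc_iff_integrableOn_Ioo]
      exact integrableOn_of_L2 f
    refine ContinuousOn.aestronglyMeasurable ?_ measurableSet_Ioo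
    exact (((act (diagD d)).continuous.comp_continuousOn hc).const_smul Complex.I).mono
      Ioo_subset_Icc_self

/-- The bounded operator `A = i D ∫₀ˣ · dt` on `L²_p(0,l)`. -/
def opA {p : ℕ} (l : ℝ) (d : Fin p → ℝ) : L2 p l →L[ℂ] L2 p l :=
  LinearMap.mkContinuousOfExistsBound
    { toFun := fun f => (memLp_volterraFun d f).toLp _
      map_add' := fun f g => by
        rw [← MemLp.toLp_add]
        refine MemLp.toLp_congr _ _ ?_
        filter_upwards [ae_restrict_mem measurableSet_Ioo] with x hx
        have h : ∫ t in (0 : ℝ)..x, (f + g : L2 p l) t = ∫ t in (0 : ℝ)..x, (f t + g t) := by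
          refine intervalIntegral.integral_congr_ae_restrict ?_
          refine ae_restrict_of_ae_restrict_of_subset ?_ (Lp.coeFn_add f g)
          rw [uIoc_of_le hx.1.le]
          exact fun _ ht => ⟨ht.1, ht.2.trans_lt hx.2⟩
        simp only [volterraFun, Pi.add_apply]
        rw [h, intervalIntegral.integral_add (intervalIntegrable_of_L2 f hx)
          (intervalIntegrable_of_L2 g hx), map_add, smul_add]
      map_smul' := fun c f => by
        rw [RingHom.id_apply, ← MemLp.toLp_const_smul]
        refine MemLp.toLp_congr _ _ ?_
        filter_upwards [ae_restrict_mem measurableSet_Ioo] with x hx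
        have h : ∫ t in (0 : ℝ)..x, (c • f : L2 p l) t = ∫ t in (0 : ℝ)..x, c • f t := by
          refine intervalIntegral.integral_congr_ae_restrict ?_
          refine ae_restrict_of_ae_restrict_of_subset ?_ (Lp.coeFn_smul c f)
          rw [uIoc_of_le hx.1.le]
          exact fun _ ht => ⟨ht.1, ht.2.trans_lt hx.2⟩
        simp only [volterraFun, Pi.smul_apply]
        rw [h, intervalIntegral.integral_smul, map_smul, smul_comm] }
    (by
      set K := ((volume.restrict (Ioo (0 : ℝ) l)) univ ^ (1 / 2 : ℝ)).toReal with hK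
      refine ⟨measureUnivNNReal (volume.restrict (Ioo (0 : ℝ) l)) ^ (2 : ENNReal).toReal⁻¹ *
        (‖act (diagD d)‖ * K), fun f => ?_⟩
      have h := Lp.norm_le_of_ae_bound (f := (memLp_volterraFun d f).toLp _)
        (C := ‖act (diagD d)‖ * (‖f‖ * K)) (by positivity) (by
          filter_upwards [ae_restrict_mem measurableSet_Ioo,
            (memLp_volterraFun d f).coeFn_toLp] with x hx hx'
          rw [hx']
          exact norm_volterraFun_le d f hx)
      refine h.trans (le_of_eq ?_)
      ring)

theorem opA_coeFn {p : ℕ} {l : ℝ} (d : Fin p → ℝ) (f : L2 p l) :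
    opA l d f =ᵐ[volume.restrict (Ioo (0 : ℝ) l)] volterraFun d f :=
  (memLp_volterraFun d f).coeFn_toLp

/-- The operator identity `A S - S A^* = i ∫₀ˡ (Φ₁(x) + Φ̂₁(t)) · dt` in `L²_p(0,l)`. -/
def OperatorIdentity {p : ℕ} (l : ℝ) (d : Fin p → ℝ) (S : L2 p l →L[ℂ] L2 p l)
    (Φ Φh : ℝ → Matrix (Fin p) (Fin p) ℂ) : Prop :=
  ∀ f : L2 p l, ∀ᵐ x ∂volume.restrict (Ioo (0 : ℝ) l),
    (opA l d ∘L S - S ∘L ContinuousLinearMap.adjoint (opA l d)) f x =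
      Complex.I • ∫ t in (0 : ℝ)..l, act (Φ x + Φh t) (f t)

/-- The matrix function of two variables `s(x,t) = {s_{ij}(d_i x - d_j t)}`. -/
def kernel {p : ℕ} (d : Fin p → ℝ) (s : Fin p → Fin p → ℝ → ℂ) (x t : ℝ) :
    Matrix (Fin p) (Fin p) ℂ :=
  Matrix.of fun i j => s i j (d i * x - d j * t)

/-- `S` is the operator with the `D`-difference kernel `s`:
`s_{ij} ∈ L²(-d_j l, d_i l)` and `S f = d/dx ∫₀ˡ s(x,t) f(t) dt` for all `f ∈ L²_p(0,l)`. Here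
`d/dx` is applied to an absolutely continuous function on `[0,l]`, and so it exists
almost everywhere. -/
structure HasDDifferenceKernel {p : ℕ} (l : ℝ) (d : Fin p → ℝ) (S : L2 p l →L[ℂ] L2 p l)
    (s : Fin p → Fin p → ℝ → ℂ) : Prop where
  memLp : ∀ i j, MemLp (s i j) 2 (volume.restrict (Ioo (-(d j * l)) (d i * l)))
  absCont : ∀ f : L2 p l,
    AbsolutelyContinuousOnInterval (fun x => ∫ t in (0 : ℝ)..l, act (kernel d s x t) (f t)) 0 l
  hasDeriv : ∀ f : L2 p l, ∀ᵐ x ∂volume.restrict (Ioo (0 : ℝ) l),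
    HasDerivAt (fun y => ∫ t in (0 : ℝ)..l, act (kernel d s y t) (f t)) (S f x) x

end DDiff

end

namespace DDiff

/-! Everything is read off the matrix elements `P(x,y) = ⟨1_(0,x) e_i, S 1_(0,y) e_j⟩`, which are
jointly continuous. Since `A` integrates in the endpoint of a step function, the operator identity
becomes an integrated transport equation: `d_i ∫₀ˣ P(ξ,y) dξ + d_j ∫₀ʸ P(x,η) dη` equals `y ∫₀ˣ Φ_ij
+ x ∫₀ʸ Φ̂_ij`.

The prescribed values on the axes determine a candidate `s_ij` (`kernelFun`), extended by zero to
the line. With `σ` its primitive, `d_j⁻¹ (σ(d_i x) - σ(d_i x - d_j y) + σ(-d_j y))` solves the same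
equation (`transport_increment`). Continuous solutions are unique because the homogeneous equation
propagates zero boundary values along characteristics (`eq_zero_of_transport`).

The resulting formula says that `S* 1_(0,x) e_i` is the conjugated row `i` of `s(x,·) - s(0,·)`.
Pairing with `f` gives `∫ s(x,t) f(t) dt = ∫ s(0,t) f(t) dt + ∫₀ˣ S f`, hence absolute continuity
and the derivative. If `Φ̂ = Φ*`, the symmetry of `s` passes to the matrix elements, and step
functions are total, so `S = S*`. -/

/-! ### The integrated transport equation: uniqueness and an explicit solution. -/

theorem hasDerivAt_integral_fst {E : ℝ → ℝ → ℂ} (hE : Continuous (Function.uncurry E)) (x y : ℝ) :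
    HasDerivAt (fun x => ∫ ξ in (0 : ℝ)..x, ∫ η in (0 : ℝ)..y, E ξ η) (∫ η in (0 : ℝ)..y, E x η) x :=
  (Continuous.integral_hasStrictDerivAt
    (intervalIntegral.continuous_parametric_intervalIntegral_of_continuous' hE 0 y) 0 x).hasDerivAt

theorem integral_integral_swap_of_continuous {E : ℝ → ℝ → ℂ}
    (hE : Continuous (Function.uncurry E)) (x y : ℝ) :
    ∫ ξ in (0 : ℝ)..x, ∫ η in (0 : ℝ)..y, E ξ η = ∫ η in (0 : ℝ)..y, ∫ ξ in (0 : ℝ)..x, E ξ η := by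
  refine intervalIntegral_intervalIntegral_swap ?_
  refine (hE.continuousOn.integrableOn_compact
    ((isCompact_uIcc (a := (0 : ℝ)) (b := x)).prod (isCompact_uIcc (a := (0 : ℝ)) (b := y)))).mono_set ?_
  exact prod_mono uIoc_subset_uIcc uIoc_subset_uIcc

theorem hasDerivAt_integral_snd {E : ℝ → ℝ → ℂ} (hE : Continuous (Function.uncurry E)) (x y : ℝ) :
    HasDerivAt (fun y => ∫ ξ in (0 : ℝ)..x, ∫ η in (0 : ℝ)..y, E ξ η)
      (∫ ξ in (0 : ℝ)..x, E ξ y) y := by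
  simp only [integral_integral_swap_of_continuous hE]
  exact hasDerivAt_integral_fst (E := fun η ξ => E ξ η) (hE.comp continuous_swap) y x

/-- Although `E` is merely continuous, both partial derivatives of its double primitive are
continuous, so the chain rule applies along characteristics. -/
theorem hasStrictFDerivAt_integral_integral {E : ℝ → ℝ → ℂ}
    (hE : Continuous (Function.uncurry E)) (u : ℝ × ℝ) :
    HasStrictFDerivAt (fun z : ℝ × ℝ => ∫ ξ in (0 : ℝ)..z.1, ∫ η in (0 : ℝ)..z.2, E ξ η)
      ((ContinuousLinearMap.toSpanSingleton ℝ (∫ η in (0 : ℝ)..u.2, E u.1 η)).coprod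
        (ContinuousLinearMap.toSpanSingleton ℝ (∫ ξ in (0 : ℝ)..u.1, E ξ u.2))) u := by
  have h1 : Continuous fun z : ℝ × ℝ => ∫ η in (0 : ℝ)..z.2, E z.1 η :=
    intervalIntegral.continuous_parametric_intervalIntegral_of_continuous
      (f := fun z : ℝ × ℝ => E z.1)
      (hE.comp ((continuous_fst.comp continuous_fst).prodMk continuous_snd)) continuous_snd
  have h2 : Continuous fun z : ℝ × ℝ => ∫ ξ in (0 : ℝ)..z.1, E ξ z.2 :=
    intervalIntegral.continuous_parametric_intervalIntegral_of_continuous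
      (f := fun (z : ℝ × ℝ) ξ => E ξ z.2)
      (hE.comp (continuous_snd.prodMk (continuous_snd.comp continuous_fst))) continuous_fst
  have hc : Continuous fun c : ℂ => ContinuousLinearMap.toSpanSingleton ℝ c :=
    (ContinuousLinearMap.toSpanSingletonCLE (𝕜 := ℝ) (E := ℂ)).continuous
  exact hasStrictFDerivAt_uncurry_coprod
    (f := fun x y => ∫ ξ in (0 : ℝ)..x, ∫ η in (0 : ℝ)..y, E ξ η)
    (f₁ := fun x y => ContinuousLinearMap.toSpanSingleton ℝ (∫ η in (0 : ℝ)..y, E x η))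
    (f₂ := fun x y => ContinuousLinearMap.toSpanSingleton ℝ (∫ ξ in (0 : ℝ)..x, E ξ y))
    (Filter.Eventually.of_forall fun v => (hasDerivAt_integral_fst hE v.1 v.2).hasFDerivAt)
    (Filter.Eventually.of_forall fun v => (hasDerivAt_integral_snd hE v.1 v.2).hasFDerivAt)
    (hc.comp h1).continuousAt (hc.comp h2).continuousAt

/-- A continuous solution of the integrated homogeneous transport equation `α v_y + β v_x = 0`
with zero boundary values vanishes. -/
theorem eq_zero_of_transport {E : ℝ → ℝ → ℂ} (hE : Continuous (Function.uncurry E)) {l α β : ℝ}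
    (hl : 0 < l) (hα : 0 < α) (hβ : 0 < β)
    (h : ∀ x ∈ Icc 0 l, ∀ y ∈ Icc 0 l,
      α • (∫ ξ in (0 : ℝ)..x, E ξ y) + β • (∫ η in (0 : ℝ)..y, E x η) = 0) :
    ∀ x ∈ Icc 0 l, ∀ y ∈ Icc 0 l, E x y = 0 := by
  set v : ℝ × ℝ → ℂ := fun z => ∫ ξ in (0 : ℝ)..z.1, ∫ η in (0 : ℝ)..z.2, E ξ η with hv
  have hv0 : ∀ x ∈ Icc 0 l, ∀ y ∈ Icc 0 l, v (x, y) = 0 := by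
    intro x hx y hy
    -- `T` is the time at which the characteristic through `(x, y)`, followed backwards with
    -- velocity `(-β, -α)`, first meets a coordinate axis, where `v = 0`.
    set T := min (x / β) (y / α) with hT
    have hT0 : 0 ≤ T := le_min (div_nonneg hx.1 hβ.le) (div_nonneg hy.1 hα.le)
    have hT1 : T * β ≤ x := (le_div_iff₀ hβ).1 (min_le_left _ _)
    have hT2 : T * α ≤ y := (le_div_iff₀ hα).1 (min_le_right _ _)
    have hd : ∀ s ∈ Icc 0 T,
        HasDerivAt (fun s => v (x - s * β, y - s * α)) 0 s := by
      intro s hs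
      have hc : HasDerivAt (fun s : ℝ => (x - s * β, y - s * α)) (-β, -α) s := by
        refine HasDerivAt.prodMk ?_ ?_
        · simpa using ((hasDerivAt_id s).mul_const β).const_sub x
        · simpa using ((hasDerivAt_id s).mul_const α).const_sub y
      have := (hasStrictFDerivAt_integral_integral hE
        (x - s * β, y - s * α)).hasFDerivAt.comp_hasDerivAt s hc
      refine this.congr_deriv ?_
      have h1 : s * β ≤ T * β := mul_le_mul_of_nonneg_right hs.2 hβ.le
      have h2 : s * α ≤ T * α := mul_le_mul_of_nonneg_right hs.2 hα.le
      have h3 : 0 ≤ s * β := mul_nonneg hs.1 hβ.le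
      have h4 : 0 ≤ s * α := mul_nonneg hs.1 hα.le
      have := h (x - s * β) ⟨by linarith, by linarith [hx.2]⟩ (y - s * α)
        ⟨by linarith, by linarith [hy.2]⟩
      simp only [ContinuousLinearMap.coprod_apply, ContinuousLinearMap.toSpanSingleton_apply,
        neg_smul]
      rw [← neg_add, add_comm, this, neg_zero]
    have hconst := constant_of_has_deriv_right_zero
      (fun s hs => (hd s hs).continuousAt.continuousWithinAt)
      (fun s hs => (hd s (Ico_subset_Icc_self hs)).hasDerivWithinAt) T (right_mem_Icc.2 hT0)
    simp only [zero_mul, sub_zero] at hconst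
    rw [← hconst]
    rcases min_choice (x / β) (y / α) with h' | h'
    · rw [hT, h', div_mul_cancel₀ _ hβ.ne', sub_self, hv]; simp
    · rw [hT, h', div_mul_cancel₀ _ hα.ne', sub_self, hv]; simp
  -- `E` is the mixed derivative of `v`. Derivatives within `Icc 0 l` are unique, so the endpoints
  -- are covered too.
  have hw : ∀ x ∈ Icc 0 l, ∀ y ∈ Icc 0 l, ∫ η in (0 : ℝ)..y, E x η = 0 := by
    intro x hx y hy
    refine (uniqueDiffOn_Icc hl x hx).eq_deriv _ (hasDerivAt_integral_fst hE x y).hasDerivWithinAt ?_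
    exact (hasDerivWithinAt_const x _ 0).congr (fun x' hx' => hv0 x' hx' y hy) (hv0 x hx y hy)
  intro x hx y hy
  have hEx : Continuous (E x) := hE.comp (continuous_const.prodMk continuous_id)
  refine (uniqueDiffOn_Icc hl y hy).eq_deriv _
    (hEx.integral_hasStrictDerivAt 0 y).hasDerivAt.hasDerivWithinAt ?_
  exact (hasDerivWithinAt_const y _ 0).congr (fun y' hy' => hw x hx y' hy') (hw x hx y hy)

/-- The increments `σ(αx) - σ(αx - βy) - σ(0) + σ(-βy)` solve the integrated transport equation. -/
theorem transport_increment {σ : ℝ → ℂ} (hσ : Continuous σ) (α β x y : ℝ) :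
    α • (∫ ξ in (0 : ℝ)..x, (σ (α * ξ) - σ (α * ξ - β * y) - σ 0 + σ (-(β * y)))) +
      β • (∫ η in (0 : ℝ)..y, (σ (α * x) - σ (α * x - β * η) - σ 0 + σ (-(β * η)))) =
    (α * x) • (σ (-(β * y)) - σ 0) + (β * y) • (σ (α * x) - σ 0) := by
  have hi : ∀ {f : ℝ → ℂ}, Continuous f → ∀ a b : ℝ, IntervalIntegrable f volume a b :=
    fun hf a b => hf.intervalIntegrable a b
  rw [intervalIntegral.integral_add (hi (by fun_prop) _ _) (hi (by fun_prop) _ _),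
    intervalIntegral.integral_sub (hi (by fun_prop) _ _) (hi (by fun_prop) _ _),
    intervalIntegral.integral_sub (hi (by fun_prop) _ _) (hi (by fun_prop) _ _),
    intervalIntegral.integral_add (hi (by fun_prop) _ _) (hi (by fun_prop) _ _),
    intervalIntegral.integral_sub (hi (by fun_prop) _ _) (hi (by fun_prop) _ _),
    intervalIntegral.integral_sub (hi (by fun_prop) _ _) (hi (by fun_prop) _ _)]
  simp only [smul_add, smul_sub]
  have e1 := intervalIntegral.smul_integral_comp_mul_left (a := 0) (b := x) σ α
  have e2 := intervalIntegral.smul_integral_comp_mul_sub (a := 0) (b := x) σ α (β * y)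
  have e3 := intervalIntegral.smul_integral_comp_sub_mul (a := 0) (b := y) σ β (α * x)
  have e4 := intervalIntegral.smul_integral_comp_mul_left (a := 0) (b := y) (fun v => σ (-v)) β
  rw [e1, e2, e3, e4]
  simp only [intervalIntegral.integral_const, intervalIntegral.integral_comp_neg, mul_zero,
    zero_sub, sub_zero, neg_zero]
  -- After substitution every integral is one of `σ`. The interval from `-βy` to `αx` is split at
  -- `0` and at `αx - βy`, and the two splittings cancel; no derivative of `σ` is needed.
  have a1 := intervalIntegral.integral_add_adjacent_intervals
    (hi hσ (-(β * y)) 0) (hi hσ 0 (α * x))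
  have a2 := intervalIntegral.integral_add_adjacent_intervals
    (hi hσ (-(β * y)) (α * x - β * y)) (hi hσ (α * x - β * y) (α * x))
  simp only [smul_smul]
  linear_combination a1 - a2

/-! ### Step functions and their inner products. -/

variable {p : ℕ} {l : ℝ}

theorem act_apply (M : Matrix (Fin p) (Fin p) ℂ) (v : EuclideanSpace ℂ (Fin p)) (i : Fin p) :
    act M v i = ∑ j, M i j * v j := by
  rw [act, Matrix.ofLp_toEuclideanCLM]
  rfl

theorem intervalIntegral_conj (f : ℝ → ℂ) (a b : ℝ) :
    starRingEnd ℂ (∫ t in a..b, f t) = ∫ t in a..b, starRingEnd ℂ (f t) := by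
  simp only [intervalIntegral, map_sub, integral_conj]

/-- The step function `1_{(0,x)} e_i`. -/
noncomputable def stepFun (l x : ℝ) (i : Fin p) : L2 p l :=
  indicatorConstLp 2 (measurableSet_Iio (a := x)) (measure_ne_top _ _)
    (EuclideanSpace.single i (1 : ℂ))

theorem intervalIntegrable_of_L2_Icc {x : ℝ} (f : L2 p l) (hx : x ∈ Icc (0 : ℝ) l) :
    IntervalIntegrable f volume 0 x := by
  refine (intervalIntegrable_iff_integrableOn_Ioo_of_le hx.1).2 ?_
  exact (integrableOn_of_L2 f).mono_set (Ioo_subset_Ioo_right hx.2)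

theorem restrict_restrict_Iio {x : ℝ} (hx : x ≤ l) :
    (volume.restrict (Ioo (0 : ℝ) l)).restrict (Iio x) = volume.restrict (Ioo 0 x) := by
  rw [Measure.restrict_restrict measurableSet_Iio]
  congr 1
  ext t
  simp only [mem_inter_iff, mem_Iio, mem_Ioo]
  exact ⟨fun h => ⟨h.2.1, h.1⟩, fun h => ⟨h.2, h.1, h.2.trans_le hx⟩⟩

theorem integral_apply_of_L2 {x : ℝ} (f : L2 p l) (i : Fin p) (hx : x ∈ Icc (0 : ℝ) l) :
    (∫ t in (0 : ℝ)..x, f t) i = ∫ t in (0 : ℝ)..x, f t i :=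
  ((EuclideanSpace.proj (𝕜 := ℂ) i).intervalIntegral_comp_comm
    (intervalIntegrable_of_L2_Icc f hx)).symm

theorem inner_stepFun {x : ℝ} (f : L2 p l) (i : Fin p) (hx : x ∈ Icc (0 : ℝ) l) :
    inner ℂ (stepFun l x i) f = ∫ t in (0 : ℝ)..x, f t i := by
  rw [stepFun, L2.inner_indicatorConstLp_eq_inner_setIntegral, restrict_restrict_Iio hx.2,
    EuclideanSpace.inner_single_left, map_one, one_mul, ← integral_apply_of_L2 f i hx,
    intervalIntegral.integral_of_le hx.1, integral_Ioc_eq_integral_Ioo]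

/-- The symmetric difference of two of the half-lines has measure at most `|y - x|`. This supplies
the continuity that the uniqueness argument needs. -/
theorem continuous_stepFun (i : Fin p) : Continuous fun x => stepFun l x i := by
  refine continuous_indicatorConstLp_set (by norm_num) fun x => ?_
  refine tendsto_of_tendsto_of_tendsto_of_le_of_le (h := fun y => ENNReal.ofReal |y - x|)
    tendsto_const_nhds ?_ (fun _ => bot_le) fun y => ?_
  · have : Continuous fun y : ℝ => ENNReal.ofReal |y - x| :=
      ENNReal.continuous_ofReal.comp (by fun_prop)
    simpa using this.tendsto x
  · refine (Measure.restrict_apply_le _ _).trans ?_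
    change _ ≤ ENNReal.ofReal |y - x|
    rw [← Real.volume_interval]
    refine measure_mono fun t ht => ?_
    rw [mem_uIcc]
    rcases ht with ⟨h1, h2⟩ | ⟨h1, h2⟩
    · exact Or.inl ⟨not_lt.1 h2, le_of_lt h1⟩
    · exact Or.inr ⟨not_lt.1 h2, le_of_lt h1⟩

/-- These inner products are the coordinates of the primitive of `f`, so Lebesgue differentiation
recovers `f` almost everywhere. -/
theorem eq_zero_of_inner_stepFun (f : L2 p l)
    (h : ∀ x ∈ Icc (0 : ℝ) l, ∀ i, inner ℂ (stepFun l x i) f = 0) : f = 0 := by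
  rcases le_or_gt l 0 with hl | hl
  · refine Lp.ext ?_
    simp [Ioo_eq_empty_of_le hl, Filter.EventuallyEq]
  have hI := intervalIntegrable_of_L2_Icc f (right_mem_Icc.2 hl.le)
  have hz : ∀ x ∈ Icc (0 : ℝ) l, ∫ t in (0 : ℝ)..x, f t = 0 := by
    intro x hx
    ext i
    rw [integral_apply_of_L2 f i hx, ← inner_stepFun f i hx, h x hx i]
    rfl
  refine Lp.ext ?_
  filter_upwards [ae_restrict_of_ae hI.ae_hasDerivAt_integral, ae_restrict_mem measurableSet_Ioo,
    Lp.coeFn_zero (EuclideanSpace ℂ (Fin p)) 2 (volume.restrict (Ioo (0 : ℝ) l))] with x hx hx' h0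
  rw [h0]
  rw [uIcc_of_le hl.le] at hx
  refine (hx (Ioo_subset_Icc_self hx') 0 (left_mem_Icc.2 hl.le)).unique ?_
  refine (hasDerivAt_const x (0 : EuclideanSpace ℂ (Fin p))).congr_of_eventuallyEq ?_
  filter_upwards [Icc_mem_nhds hx'.1 hx'.2] with y hy using hz y hy

theorem eq_of_inner_stepFun {f g : L2 p l}
    (h : ∀ x ∈ Icc (0 : ℝ) l, ∀ i, inner ℂ (stepFun l x i) f = inner ℂ (stepFun l x i) g) :
    f = g := by
  refine sub_eq_zero.1 (eq_zero_of_inner_stepFun _ fun x hx i => ?_)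
  rw [inner_sub_right, h x hx i, sub_self]

theorem ae_restrict_uIoc_of_ae {P : ℝ → Prop} {x : ℝ} (hx : x ∈ Icc (0 : ℝ) l)
    (h : ∀ᵐ t ∂volume.restrict (Ioo (0 : ℝ) l), P t) :
    ∀ᵐ t ∂volume.restrict (uIoc (0 : ℝ) x), P t := by
  rw [uIoc_of_le hx.1, ← restrict_Ioo_eq_restrict_Ioc]
  exact ae_restrict_of_ae_restrict_of_subset (Ioo_subset_Ioo_right hx.2) h

/-! ### The operator identity on matrix elements. -/

theorem inner_stepFun_opA {x : ℝ} (d : Fin p → ℝ) (f : L2 p l) (i : Fin p)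
    (hx : x ∈ Icc (0 : ℝ) l) :
    inner ℂ (stepFun l x i) (opA l d f) =
      Complex.I * (d i • ∫ ξ in (0 : ℝ)..x, inner ℂ (stepFun l ξ i) f) := by
  rw [inner_stepFun _ i hx, ← intervalIntegral.integral_smul,
    ← intervalIntegral.integral_const_mul]
  refine intervalIntegral.integral_congr_ae_restrict ?_
  filter_upwards [ae_restrict_uIoc_of_ae hx (opA_coeFn d f), ae_restrict_mem measurableSet_uIoc]
    with ξ h1 h2
  rw [uIoc_of_le hx.1] at h2
  have hξ : ξ ∈ Icc (0 : ℝ) l := ⟨h2.1.le, h2.2.trans hx.2⟩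
  rw [h1, inner_stepFun f i hξ, ← integral_apply_of_L2 f i hξ, volterraFun]
  simp [act_apply, diagD, Matrix.diagonal_apply]

/-- The matrix elements of `A S - S A*` in terms of those of `S`. -/
theorem inner_stepFun_commutator {x y : ℝ} (d : Fin p → ℝ) (S : L2 p l →L[ℂ] L2 p l)
    (i j : Fin p) (hx : x ∈ Icc (0 : ℝ) l) (hy : y ∈ Icc (0 : ℝ) l) :
    inner ℂ (stepFun l x i)
      ((opA l d ∘L S - S ∘L ContinuousLinearMap.adjoint (opA l d)) (stepFun l y j)) =
    Complex.I * (d i • (∫ ξ in (0 : ℝ)..x, inner ℂ (stepFun l ξ i) (S (stepFun l y j))) +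
      d j • (∫ η in (0 : ℝ)..y, inner ℂ (stepFun l x i) (S (stepFun l η j)))) := by
  -- No formula for `A*` is needed: `S` and `A*` are moved to the left argument, and conjugate
  -- symmetry reduces to the formula for `A`. Conjugating `I` turns the minus sign into a plus.
  rw [_root_.sub_apply, inner_sub_right, ContinuousLinearMap.comp_apply,
    ContinuousLinearMap.comp_apply, inner_stepFun_opA d _ i hx,
    ← ContinuousLinearMap.adjoint_inner_left, ContinuousLinearMap.adjoint_inner_right,
    ← inner_conj_symm, inner_stepFun_opA d _ j hy, map_mul, Complex.conj_I, Complex.real_smul,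
    Complex.real_smul, Complex.real_smul, map_mul, Complex.conj_ofReal]
  simp only [intervalIntegral_conj, inner_conj_symm, ContinuousLinearMap.adjoint_inner_left]
  ring

theorem intervalIntegrable_entry {Φ : ℝ → Matrix (Fin p) (Fin p) ℂ} (hΦ : EntriesL2 l Φ)
    (i j : Fin p) {x : ℝ} (hx : x ∈ Icc (0 : ℝ) l) :
    IntervalIntegrable (fun t => Φ t i j) volume 0 x := by
  refine (intervalIntegrable_iff_integrableOn_Ioo_of_le hx.1).2 ?_
  have h : IntegrableOn (fun t => Φ t i j) (Ioo (0 : ℝ) l) := (hΦ i j).integrable (by norm_num)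
  exact h.mono_set (Ioo_subset_Ioo_right hx.2)

theorem act_stepFun_integral {Φh : ℝ → Matrix (Fin p) (Fin p) ℂ} (hΦh : EntriesL2 l Φh)
    (M : Matrix (Fin p) (Fin p) ℂ) (i j : Fin p) {y : ℝ} (hy : y ∈ Icc (0 : ℝ) l) :
    (∫ t in (0 : ℝ)..l, act (M + Φh t) (stepFun l y j t)) i =
      y • M i j + ∫ t in (0 : ℝ)..y, Φh t i j := by
  have hl : 0 ≤ l := hy.1.trans hy.2
  have he : ∀ k, (fun t => act (M + Φh t) (stepFun l y j t) k) =ᵐ[volume.restrict (Ioo 0 l)]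
      (Iio y).indicator fun t => M k j + Φh t k j := by
    intro k
    filter_upwards [indicatorConstLp_coeFn (p := 2) (μ := volume.restrict (Ioo 0 l))
      (s := Iio y) (hs := measurableSet_Iio) (hμs := measure_ne_top _ _)
      (c := EuclideanSpace.single j (1 : ℂ))] with t ht
    rw [stepFun, ht]
    by_cases h : t ∈ Iio y
    · simp [h, act_apply]
    · simp [h]
  have hint : ∀ k, Integrable (fun t => act (M + Φh t) (stepFun l y j t) k)
      (volume.restrict (Ioo 0 l)) := by
    intro k
    refine Integrable.congr ?_ (he k).symm
    exact ((integrable_const _).add ((hΦh k j).integrable (by norm_num))).indicator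
      measurableSet_Iio
  rw [intervalIntegral.integral_of_le hl, integral_Ioc_eq_integral_Ioo, eval_integral_piLp hint,
    integral_congr_ae (he i), integral_indicator measurableSet_Iio, restrict_restrict_Iio hy.2,
    ← integral_Ioc_eq_integral_Ioo, ← intervalIntegral.integral_of_le hy.1,
    intervalIntegral.integral_add (by simp) (intervalIntegrable_entry hΦh i j hy)]
  simp

/-- The operator identity in terms of the matrix elements of `S`. -/
theorem OperatorIdentity.transport {d : Fin p → ℝ} {S : L2 p l →L[ℂ] L2 p l}
    {Φ Φh : ℝ → Matrix (Fin p) (Fin p) ℂ} (hS : OperatorIdentity l d S Φ Φh)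
    (hΦ : EntriesL2 l Φ) (hΦh : EntriesL2 l Φh) (i j : Fin p) {x y : ℝ}
    (hx : x ∈ Icc (0 : ℝ) l) (hy : y ∈ Icc (0 : ℝ) l) :
    d i • (∫ ξ in (0 : ℝ)..x, inner ℂ (stepFun l ξ i) (S (stepFun l y j))) +
      d j • (∫ η in (0 : ℝ)..y, inner ℂ (stepFun l x i) (S (stepFun l η j))) =
    y • (∫ t in (0 : ℝ)..x, Φ t i j) + x • (∫ t in (0 : ℝ)..y, Φh t i j) := by
  have h := inner_stepFun_commutator d S i j hx hy
  rw [inner_stepFun _ i hx] at h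
  refine mul_left_cancel₀ Complex.I_ne_zero (h.symm.trans ?_)
  have : ∫ t in (0 : ℝ)..x, ((opA l d ∘L S - S ∘L ContinuousLinearMap.adjoint (opA l d))
        (stepFun l y j)) t i =
      ∫ t in (0 : ℝ)..x, Complex.I * (y • Φ t i j + ∫ t in (0 : ℝ)..y, Φh t i j) := by
    refine intervalIntegral.integral_congr_ae_restrict ?_
    filter_upwards [ae_restrict_uIoc_of_ae hx (hS (stepFun l y j))] with t ht
    rw [ht, PiLp.smul_apply, act_stepFun_integral hΦh _ _ _ hy, smul_eq_mul]
  rw [this, intervalIntegral.integral_const_mul,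
    intervalIntegral.integral_add (f := fun t => y • Φ t i j)
      ((intervalIntegrable_entry hΦ i j hx).smul y) (by simp),
    intervalIntegral.integral_smul]
  simp

/-! ### The candidate kernel and its symmetry. -/

theorem memLp_comp_mul_left {g : ℝ → ℂ} (hg : MemLp g 2 volume) {c : ℝ} (hc : c ≠ 0) :
    MemLp (fun v => g (c * v)) 2 volume := by
  refine MemLp.comp_of_map (f := fun v => c * v) ?_ (by fun_prop)
  rw [Real.map_volume_mul_left hc]
  exact hg.smul_measure ENNReal.ofReal_ne_top

theorem memLp_comp_sub_mul {g : ℝ → ℂ} (hg : MemLp g 2 volume) (a : ℝ) {b : ℝ} (hb : b ≠ 0) :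
    MemLp (fun t => g (a - b * t)) 2 volume :=
  memLp_comp_mul_left (g := fun v => g (a - v))
    (hg.comp_measurePreserving (Measure.measurePreserving_sub_left volume a)) hb

/-- The function `s_{ij}` of one variable with `s_{ij}(d_i u) = d_i⁻¹ Φ_{ij}(u)` and
`s_{ij}(-d_j u) = -d_i⁻¹ Φ̂_{ij}(u)` for `0 < u < l`. -/
noncomputable def kernelFun (l : ℝ) (d : Fin p → ℝ) (Φ Φh : ℝ → Matrix (Fin p) (Fin p) ℂ)
    (i j : Fin p) (v : ℝ) : ℂ :=
  (d i)⁻¹ • ((Ioo 0 l).indicator (fun u => Φ u i j) ((d i)⁻¹ * v) -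
    (Ioo 0 l).indicator (fun u => Φh u i j) (-(d j)⁻¹ * v))

theorem memLp_kernelFun {d : Fin p → ℝ} (hd : ∀ i, 0 < d i) {Φ Φh : ℝ → Matrix (Fin p) (Fin p) ℂ}
    (hΦ : EntriesL2 l Φ) (hΦh : EntriesL2 l Φh) (i j : Fin p) :
    MemLp (kernelFun l d Φ Φh i j) 2 volume := by
  have h1 := memLp_comp_mul_left ((memLp_indicator_iff_restrict measurableSet_Ioo).2 (hΦ i j))
    (inv_ne_zero (hd i).ne')
  have h2 := memLp_comp_mul_left ((memLp_indicator_iff_restrict measurableSet_Ioo).2 (hΦh i j))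
    (neg_ne_zero.2 (inv_ne_zero (hd j).ne'))
  exact (h1.sub h2).const_smul (d i)⁻¹

theorem kernelFun_mul {d : Fin p → ℝ} (hd : ∀ i, 0 < d i) (Φ Φh : ℝ → Matrix (Fin p) (Fin p) ℂ)
    (i j : Fin p) {u : ℝ} (hu : u ∈ Ioo 0 l) :
    kernelFun l d Φ Φh i j (d i * u) = (d i)⁻¹ • Φ u i j := by
  have h : -(d j)⁻¹ * (d i * u) ∉ Ioo 0 l := fun h => by
    have := mul_pos (inv_pos.2 (hd j)) (mul_pos (hd i) hu.1)
    linarith [h.1]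
  rw [kernelFun, inv_mul_cancel_left₀ (hd i).ne', indicator_of_mem hu, indicator_of_notMem h,
    sub_zero]

theorem kernelFun_neg_mul {d : Fin p → ℝ} (hd : ∀ i, 0 < d i)
    (Φ Φh : ℝ → Matrix (Fin p) (Fin p) ℂ) (i j : Fin p) {u : ℝ} (hu : u ∈ Ioo 0 l) :
    kernelFun l d Φ Φh i j (-(d j * u)) = -((d i)⁻¹ • Φh u i j) := by
  have h : (d i)⁻¹ * -(d j * u) ∉ Ioo 0 l := fun h => by
    have := mul_pos (inv_pos.2 (hd i)) (mul_pos (hd j) hu.1)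
    linarith [h.1]
  rw [kernelFun, neg_mul_neg, inv_mul_cancel_left₀ (hd j).ne', indicator_of_mem hu,
    indicator_of_notMem h, zero_sub, smul_neg]

/-- The reflection `v ↦ -v` together with `i ↔ j` exchanges the two indicator terms; the factor
`d_i⁻¹ d_j` corrects the prefactors. -/
theorem kernelFun_symm {d : Fin p → ℝ} (hd : ∀ i, 0 < d i) {Φ Φh : ℝ → Matrix (Fin p) (Fin p) ℂ}
    (h : ∀ᵐ t ∂volume.restrict (Ioo (0 : ℝ) l), Φh t = (Φ t)ᴴ) (i j : Fin p) :
    ∀ᵐ v, kernelFun l d Φ Φh i j v =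
      -((d i)⁻¹ • d j • starRingEnd ℂ (kernelFun l d Φ Φh j i (-v))) := by
  have h' : ∀ i j, ∀ᵐ u, (Ioo 0 l).indicator (fun u => Φh u i j) u =
      starRingEnd ℂ ((Ioo 0 l).indicator (fun u => Φ u j i) u) := by
    intro i j
    filter_upwards [(ae_restrict_iff' measurableSet_Ioo).1 h] with u hu
    by_cases hm : u ∈ Ioo 0 l
    · simp [hm, hu hm]
    · simp [hm]
  have hq : ∀ {c : ℝ}, c ≠ 0 → Measure.QuasiMeasurePreserving (fun v : ℝ => c * v) :=
    fun hc => Measure.quasiMeasurePreserving_smul volume hc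
  filter_upwards [(hq (inv_ne_zero (hd i).ne')).ae (h' j i),
    (hq (neg_ne_zero.2 (inv_ne_zero (hd j).ne'))).ae (h' i j)] with v h1 h2
  have hj : (d j : ℂ) ≠ 0 := Complex.ofReal_ne_zero.2 (hd j).ne'
  rw [kernelFun, kernelFun, h2, neg_mul_neg, h1, mul_neg, ← neg_mul]
  simp only [Complex.real_smul, map_mul, map_sub, Complex.conj_ofReal, Complex.conj_conj]
  simp only [Complex.ofReal_inv]
  field_simp
  ring

theorem diagD_inv {d : Fin p → ℝ} (hd : ∀ i, 0 < d i) :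
    (diagD d)⁻¹ = Matrix.diagonal fun i => ((d i)⁻¹ : ℂ) := by
  refine Matrix.inv_eq_right_inv ?_
  rw [diagD, Matrix.diagonal_mul_diagonal, ← Matrix.diagonal_one]
  congr 1
  ext i
  exact mul_inv_cancel₀ (Complex.ofReal_ne_zero.2 (hd i).ne')

theorem kernel_symm {d : Fin p → ℝ} (hd : ∀ i, 0 < d i) {s : Fin p → Fin p → ℝ → ℂ}
    (h : ∀ i j, ∀ᵐ v, s i j v = -((d i)⁻¹ • d j • starRingEnd ℂ (s j i (-v)))) :
    ∀ᵐ z : ℝ × ℝ, kernel d s z.1 z.2 = -((diagD d)⁻¹ * (kernel d s z.2 z.1)ᴴ * diagD d) := by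
  have hq : ∀ {c : ℝ}, c ≠ 0 → Measure.QuasiMeasurePreserving (fun v : ℝ => c * v) :=
    fun hc => Measure.quasiMeasurePreserving_smul volume hc
  have hz : ∀ i j, ∀ᵐ z : ℝ × ℝ, s i j (d i * z.1 - d j * z.2) =
      -((d i)⁻¹ • d j • starRingEnd ℂ (s j i (-(d i * z.1 - d j * z.2)))) := by
    intro i j
    -- Null sets of the line pull back to null sets of the plane, since each slice in the first
    -- variable is a nonzero scaling followed by a translation.
    have h1 : Measure.QuasiMeasurePreserving (fun z : ℝ × ℝ => d i * z.1 - d j * z.2)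
        (volume.prod volume) volume :=
      QuasiMeasurePreserving.prod_of_left (by fun_prop) (Filter.Eventually.of_forall
        fun y => (measurePreserving_sub_right volume (d j * y)).quasiMeasurePreserving.comp
          (hq (hd i).ne'))
    exact h1.ae (h i j)
  filter_upwards [ae_all_iff.2 fun i => ae_all_iff.2 (hz i)] with z hz
  ext i j
  rw [diagD_inv hd, diagD, Matrix.neg_apply, Matrix.mul_diagonal, Matrix.diagonal_mul, kernel,
    Matrix.of_apply, hz i j, Matrix.conjTranspose_apply, kernel, Matrix.of_apply, neg_sub]
  simp only [Complex.real_smul, Complex.ofReal_inv, Complex.star_def]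
  ring

/-! ### Primitives and the formula for the matrix elements. -/

/-- Increments of `F` are dominated by those of the real primitive of `‖f‖`. -/
theorem absolutelyContinuousOnInterval_of_eq_integral {E : Type*} [NormedAddCommGroup E]
    [NormedSpace ℝ E] {F f : ℝ → E} {c : E} (hl : 0 ≤ l) (hf : IntervalIntegrable f volume 0 l)
    (hF : ∀ x ∈ Icc 0 l, F x = c + ∫ t in (0 : ℝ)..x, f t) :
    AbsolutelyContinuousOnInterval F 0 l := by
  have hG := hf.norm.absolutelyContinuousOnInterval_intervalIntegral left_mem_uIcc
  rw [absolutelyContinuousOnInterval_iff] at hG ⊢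
  intro ε hε
  obtain ⟨δ, hδ, h⟩ := hG ε hε
  refine ⟨δ, hδ, fun I hI hs => lt_of_le_of_lt (Finset.sum_le_sum fun k hk => ?_) (h I hI hs)⟩
  obtain ⟨h1, h2⟩ := hI.1 k hk
  have hi : ∀ {x}, x ∈ uIcc 0 l → IntervalIntegrable f volume 0 x := fun hx =>
    hf.mono_set (uIcc_subset_uIcc_left hx)
  rw [dist_eq_norm, dist_eq_norm, intervalIntegral.integral_interval_sub_left (hi h1).norm
    (hi h2).norm]
  rw [uIcc_of_le hl] at h1 h2
  rw [hF _ h1, hF _ h2, add_sub_add_left_eq_sub, intervalIntegral.integral_interval_sub_left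
    (hi (Icc_subset_uIcc h1)) (hi (Icc_subset_uIcc h2)), Real.norm_eq_abs]
  exact intervalIntegral.norm_integral_le_abs_integral_norm

theorem ae_hasDerivAt_of_eq_integral {E : Type*} [NormedAddCommGroup E]
    [NormedSpace ℝ E] [CompleteSpace E] {F f : ℝ → E} {c : E} (hl : 0 ≤ l)
    (hf : IntervalIntegrable f volume 0 l)
    (hF : ∀ x ∈ Icc 0 l, F x = c + ∫ t in (0 : ℝ)..x, f t) :
    ∀ᵐ x ∂volume.restrict (Ioo (0 : ℝ) l), HasDerivAt F (f x) x := by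
  filter_upwards [ae_restrict_of_ae hf.ae_hasDerivAt_integral, ae_restrict_mem measurableSet_Ioo]
    with x hx hx'
  rw [uIcc_of_le hl] at hx
  refine ((hx (Ioo_subset_Icc_self hx') 0 (left_mem_Icc.2 hl)).const_add c).congr_of_eventuallyEq ?_
  filter_upwards [Icc_mem_nhds hx'.1 hx'.2] with y hy using hF y hy

theorem intervalIntegrable_of_memLp {g : ℝ → ℂ} (hg : MemLp g 2 volume) (a b : ℝ) :
    IntervalIntegrable g volume a b :=
  ((hg.locallyIntegrable (by norm_num)).integrableOn_isCompact isCompact_uIcc).intervalIntegrable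

theorem continuous_primitive_of_memLp {g : ℝ → ℂ} (hg : MemLp g 2 volume) :
    Continuous fun x => ∫ t in (0 : ℝ)..x, g t :=
  intervalIntegral.continuous_primitive (intervalIntegrable_of_memLp hg) 0

theorem primitive_kernelFun_mul {d : Fin p → ℝ} (hd : ∀ i, 0 < d i)
    (Φ Φh : ℝ → Matrix (Fin p) (Fin p) ℂ) (i j : Fin p) {x : ℝ} (hx : x ∈ Icc 0 l) :
    ∫ v in (0 : ℝ)..(d i * x), kernelFun l d Φ Φh i j v = ∫ t in (0 : ℝ)..x, Φ t i j := by
  have h := intervalIntegral.smul_integral_comp_mul_left (a := 0) (b := x)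
    (kernelFun l d Φ Φh i j) (d i)
  rw [mul_zero] at h
  rw [← h, ← intervalIntegral.integral_smul]
  refine intervalIntegral.integral_congr_ae_restrict ?_
  filter_upwards [ae_restrict_uIoc_of_ae hx (ae_restrict_mem measurableSet_Ioo)] with t ht
  rw [kernelFun_mul hd Φ Φh i j ht, smul_inv_smul₀ (hd i).ne']

theorem primitive_kernelFun_neg_mul {d : Fin p → ℝ} (hd : ∀ i, 0 < d i)
    (Φ Φh : ℝ → Matrix (Fin p) (Fin p) ℂ) (i j : Fin p) {y : ℝ} (hy : y ∈ Icc 0 l) :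
    d i • ∫ v in (0 : ℝ)..(-(d j * y)), kernelFun l d Φ Φh i j v =
      d j • ∫ t in (0 : ℝ)..y, Φh t i j := by
  have h := intervalIntegral.smul_integral_comp_mul_left (a := 0) (b := y)
    (kernelFun l d Φ Φh i j) (-(d j))
  rw [mul_zero, neg_mul] at h
  rw [← h, neg_smul, ← smul_neg, ← intervalIntegral.integral_neg, smul_comm,
    ← intervalIntegral.integral_smul]
  congr 1
  refine intervalIntegral.integral_congr_ae_restrict ?_
  filter_upwards [ae_restrict_uIoc_of_ae hy (ae_restrict_mem measurableSet_Ioo)] with t ht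
  rw [neg_mul, kernelFun_neg_mul hd Φ Φh i j ht, neg_neg, smul_inv_smul₀ (hd i).ne']

theorem continuous_matrixElement (S : L2 p l →L[ℂ] L2 p l) (i j : Fin p) :
    Continuous (Function.uncurry fun x y : ℝ =>
      (inner ℂ (stepFun l x i) (S (stepFun l y j)) : ℂ)) :=
  ((continuous_stepFun i).comp continuous_fst).inner
    (S.continuous.comp ((continuous_stepFun j).comp continuous_snd))

/-- The matrix elements of an operator satisfying the operator identity. -/
theorem OperatorIdentity.matrixElement {d : Fin p → ℝ} (hl : 0 < l) (hd : ∀ i, 0 < d i)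
    {S : L2 p l →L[ℂ] L2 p l} {Φ Φh : ℝ → Matrix (Fin p) (Fin p) ℂ}
    (hS : OperatorIdentity l d S Φ Φh) (hΦ : EntriesL2 l Φ) (hΦh : EntriesL2 l Φh)
    (i j : Fin p) {x y : ℝ} (hx : x ∈ Icc (0 : ℝ) l) (hy : y ∈ Icc (0 : ℝ) l) :
    inner ℂ (stepFun l x i) (S (stepFun l y j)) = (d j)⁻¹ •
      ((∫ v in (0 : ℝ)..(d i * x), kernelFun l d Φ Φh i j v) -
        (∫ v in (0 : ℝ)..(d i * x - d j * y), kernelFun l d Φ Φh i j v) +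
        ∫ v in (0 : ℝ)..(-(d j * y)), kernelFun l d Φ Φh i j v) := by
  set σ : ℝ → ℂ := fun u => ∫ v in (0 : ℝ)..u, kernelFun l d Φ Φh i j v with hσ
  have hσc : Continuous σ := continuous_primitive_of_memLp (memLp_kernelFun hd hΦ hΦh i j)
  have hσ0 : σ 0 = 0 := intervalIntegral.integral_same
  -- The term `σ 0` is zero; it is kept so that `Q` has the shape of `transport_increment`.
  set Q : ℝ → ℝ → ℂ := fun x y => (d j)⁻¹ • (σ (d i * x) - σ (d i * x - d j * y) - σ 0 +
    σ (-(d j * y))) with hQ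
  have hQc : Continuous (Function.uncurry Q) := by
    simp only [hQ, Function.uncurry_def]
    fun_prop
  have hP := continuous_matrixElement S i j
  suffices h : inner ℂ (stepFun l x i) (S (stepFun l y j)) - Q x y = 0 by
    rw [sub_eq_zero.1 h, hQ]
    simp only [hσ0, sub_zero]
    rfl
  refine eq_zero_of_transport
    (E := fun x y => inner ℂ (stepFun l x i) (S (stepFun l y j)) - Q x y) (hP.sub hQc)
    hl (hd i) (hd j) (fun x hx y hy => ?_) x hx y hy
  have hi1 : ∀ {f : ℝ → ℝ → ℂ}, Continuous (Function.uncurry f) → ∀ y a b : ℝ,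
      IntervalIntegrable (fun x => f x y) volume a b := fun hf y a b =>
    (hf.comp (continuous_id.prodMk continuous_const)).intervalIntegrable a b
  have hi2 : ∀ {f : ℝ → ℝ → ℂ}, Continuous (Function.uncurry f) → ∀ x a b : ℝ,
      IntervalIntegrable (fun y => f x y) volume a b := fun hf y a b =>
    (hf.comp (continuous_const.prodMk continuous_id)).intervalIntegrable a b
  rw [intervalIntegral.integral_sub (hi1 hP y 0 x) (hi1 hQc y 0 x),
    intervalIntegral.integral_sub (hi2 hP x 0 y) (hi2 hQc x 0 y)]
  have h1 := hS.transport hΦ hΦh i j hx hy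
  have h2 := transport_increment hσc (d i) (d j) x y
  have h3 : σ (d i * x) = ∫ t in (0 : ℝ)..x, Φ t i j := primitive_kernelFun_mul hd Φ Φh i j hx
  have h4 : d i • σ (-(d j * y)) = d j • ∫ t in (0 : ℝ)..y, Φh t i j :=
    primitive_kernelFun_neg_mul hd Φ Φh i j hy
  have hj : (d j : ℂ) ≠ 0 := Complex.ofReal_ne_zero.2 (hd j).ne'
  simp only [hQ, intervalIntegral.integral_smul]
  simp only [hσ0, sub_zero] at h2 ⊢
  simp only [Complex.real_smul, Complex.ofReal_mul, Complex.ofReal_inv] at h1 h2 h4 ⊢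
  refine mul_left_cancel₀ hj ?_
  field_simp
  linear_combination (d j : ℂ) * h1 - h2 - (x : ℂ) * h4 - (d j : ℂ) * y * h3

/-! ### Recovering the kernel representation from the matrix elements. -/

/-- The conjugated row `i` of `s(x,t) - s(0,t)` as a function of `t`. -/
noncomputable def incrementFun (d : Fin p → ℝ) (s : Fin p → Fin p → ℝ → ℂ) (x : ℝ) (i : Fin p)
    (t : ℝ) : EuclideanSpace ℂ (Fin p) :=
  WithLp.toLp 2 fun j => starRingEnd ℂ (s i j (d i * x - d j * t) - s i j (d i * 0 - d j * t))

theorem memLp_incrementFun {d : Fin p → ℝ} (hd : ∀ i, 0 < d i) {s : Fin p → Fin p → ℝ → ℂ}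
    (hs : ∀ i j, MemLp (s i j) 2 volume) (x : ℝ) (i : Fin p) :
    MemLp (incrementFun d s x i) 2 (volume.restrict (Ioo (0 : ℝ) l)) := by
  refine memLp_piLp_iff.2 fun j => ?_
  exact (((memLp_comp_sub_mul (hs i j) _ (hd j).ne').sub
    (memLp_comp_sub_mul (hs i j) _ (hd j).ne')).restrict _).star

theorem integral_increment {s : ℝ → ℂ} (hs : MemLp s 2 volume) {b : ℝ} (hb : b ≠ 0) (a y : ℝ) :
    ∫ t in (0 : ℝ)..y, (s (a - b * t) - s (0 - b * t)) =
      b⁻¹ • ((∫ v in (0 : ℝ)..a, s v) - (∫ v in (0 : ℝ)..(a - b * y), s v) +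
        ∫ v in (0 : ℝ)..(-(b * y)), s v) := by
  have hi := intervalIntegrable_of_memLp hs
  rw [intervalIntegral.integral_sub
    (intervalIntegrable_of_memLp (memLp_comp_sub_mul hs a hb) 0 y)
    (intervalIntegrable_of_memLp (memLp_comp_sub_mul hs 0 hb) 0 y),
    intervalIntegral.integral_comp_sub_mul _ hb, intervalIntegral.integral_comp_sub_mul _ hb,
    ← smul_sub, mul_zero, sub_zero, sub_zero, zero_sub,
    intervalIntegral.integral_interval_sub_left (hi _ _) (hi _ _),
    intervalIntegral.integral_symm 0 (-(b * y)), sub_neg_eq_add]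

/-- The operator with matrix elements given by the primitives of `s` integrates the difference
of the kernel `s`. -/
theorem adjoint_stepFun {d : Fin p → ℝ} (hd : ∀ i, 0 < d i) {s : Fin p → Fin p → ℝ → ℂ}
    (hs : ∀ i j, MemLp (s i j) 2 volume) {S : L2 p l →L[ℂ] L2 p l} {x : ℝ} (i : Fin p)
    (h : ∀ j, ∀ y ∈ Icc (0 : ℝ) l, inner ℂ (stepFun l x i) (S (stepFun l y j)) = (d j)⁻¹ •
      ((∫ v in (0 : ℝ)..(d i * x), s i j v) - (∫ v in (0 : ℝ)..(d i * x - d j * y), s i j v) +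
        ∫ v in (0 : ℝ)..(-(d j * y)), s i j v)) :
    ContinuousLinearMap.adjoint S (stepFun l x i) = (memLp_incrementFun hd hs x i).toLp _ := by
  refine eq_of_inner_stepFun fun y hy j => ?_
  rw [ContinuousLinearMap.adjoint_inner_right, ← inner_conj_symm, h j y hy, inner_stepFun _ _ hy,
    ← integral_increment (hs i j) (hd j).ne', intervalIntegral_conj]
  refine (intervalIntegral.integral_congr_ae_restrict ?_).symm
  filter_upwards [ae_restrict_uIoc_of_ae hy (memLp_incrementFun hd hs x i).coeFn_toLp] with t ht
  rw [ht]
  simp [incrementFun]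

theorem integrable_kernel_entry {d : Fin p → ℝ} (hd : ∀ i, 0 < d i) {s : Fin p → Fin p → ℝ → ℂ}
    (hs : ∀ i j, MemLp (s i j) 2 volume) (f : L2 p l) (x : ℝ) (i j : Fin p) :
    Integrable (fun t => kernel d s x t i j * f t j) (volume.restrict (Ioo (0 : ℝ) l)) :=
  MemLp.integrable_mul ((memLp_comp_sub_mul (hs i j) (d i * x) (hd j).ne').restrict _)
    ((Lp.memLp f).eval_piLp j)

theorem integral_kernel_apply {d : Fin p → ℝ} (hl : 0 ≤ l) (hd : ∀ i, 0 < d i)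
    {s : Fin p → Fin p → ℝ → ℂ} (hs : ∀ i j, MemLp (s i j) 2 volume) (f : L2 p l) (x : ℝ)
    (i : Fin p) :
    (∫ t in (0 : ℝ)..l, act (kernel d s x t) (f t)) i =
      ∑ j, ∫ t in Ioo (0 : ℝ) l, kernel d s x t i j * f t j := by
  rw [intervalIntegral.integral_of_le hl, integral_Ioc_eq_integral_Ioo, eval_integral_piLp]
  · simp only [act_apply]
    exact integral_finsetSum _ fun j _ => integrable_kernel_entry hd hs f x i j
  · intro k
    simp only [act_apply]
    exact integrable_finsetSum _ fun j _ => integrable_kernel_entry hd hs f x k j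

theorem inner_incrementFun {d : Fin p → ℝ} (hl : 0 ≤ l) (hd : ∀ i, 0 < d i)
    {s : Fin p → Fin p → ℝ → ℂ} (hs : ∀ i j, MemLp (s i j) 2 volume) (f : L2 p l) (x : ℝ)
    (i : Fin p) :
    inner ℂ ((memLp_incrementFun hd hs x i).toLp _) f =
      (∫ t in (0 : ℝ)..l, act (kernel d s x t) (f t)) i -
        (∫ t in (0 : ℝ)..l, act (kernel d s 0 t) (f t)) i := by
  rw [integral_kernel_apply hl hd hs, integral_kernel_apply hl hd hs, ← Finset.sum_sub_distrib,
    L2.inner_def]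
  simp only [← integral_sub (integrable_kernel_entry hd hs f x i _)
    (integrable_kernel_entry hd hs f 0 i _)]
  have hint : ∀ j ∈ Finset.univ, Integrable (fun t => kernel d s x t i j * f t j -
      kernel d s 0 t i j * f t j) (volume.restrict (Ioo (0 : ℝ) l)) := fun j _ =>
    (integrable_kernel_entry hd hs f x i j).sub (integrable_kernel_entry hd hs f 0 i j)
  rw [← integral_finsetSum _ hint]
  refine integral_congr_ae ?_
  filter_upwards [(memLp_incrementFun hd hs x i).coeFn_toLp] with t ht
  rw [ht, PiLp.inner_apply]
  refine Finset.sum_congr rfl fun j _ => ?_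
  simp only [incrementFun, RCLike.inner_apply, Complex.conj_conj, kernel, Matrix.of_apply]
  ring

/-- Coordinate `i` of `∫₀ˣ S f` is `⟨S* 1_(0,x) e_i, f⟩`, and `adjoint_stepFun` identifies the left
vector. This is the representation of `S` in integrated form. -/
theorem integral_kernel_eq {d : Fin p → ℝ} (hd : ∀ i, 0 < d i) {s : Fin p → Fin p → ℝ → ℂ}
    (hs : ∀ i j, MemLp (s i j) 2 volume) {S : L2 p l →L[ℂ] L2 p l}
    (h : ∀ i j, ∀ x ∈ Icc (0 : ℝ) l, ∀ y ∈ Icc (0 : ℝ) l,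
      inner ℂ (stepFun l x i) (S (stepFun l y j)) = (d j)⁻¹ •
      ((∫ v in (0 : ℝ)..(d i * x), s i j v) - (∫ v in (0 : ℝ)..(d i * x - d j * y), s i j v) +
        ∫ v in (0 : ℝ)..(-(d j * y)), s i j v)) (f : L2 p l) :
    ∀ x ∈ Icc (0 : ℝ) l, ∫ t in (0 : ℝ)..l, act (kernel d s x t) (f t) =
      (∫ t in (0 : ℝ)..l, act (kernel d s 0 t) (f t)) + ∫ t in (0 : ℝ)..x, S f t := by
  intro x hx
  ext i
  rw [PiLp.add_apply, integral_apply_of_L2 _ i hx, ← inner_stepFun _ i hx,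
    ← ContinuousLinearMap.adjoint_inner_left, adjoint_stepFun hd hs i fun j => h i j x hx,
    inner_incrementFun (hx.1.trans hx.2) hd hs, add_sub_cancel]

theorem hasDDifferenceKernel_of_matrixElement {d : Fin p → ℝ} (hl : 0 ≤ l) (hd : ∀ i, 0 < d i)
    {s : Fin p → Fin p → ℝ → ℂ} (hs : ∀ i j, MemLp (s i j) 2 volume) {S : L2 p l →L[ℂ] L2 p l}
    (h : ∀ i j, ∀ x ∈ Icc (0 : ℝ) l, ∀ y ∈ Icc (0 : ℝ) l,
      inner ℂ (stepFun l x i) (S (stepFun l y j)) = (d j)⁻¹ •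
      ((∫ v in (0 : ℝ)..(d i * x), s i j v) - (∫ v in (0 : ℝ)..(d i * x - d j * y), s i j v) +
        ∫ v in (0 : ℝ)..(-(d j * y)), s i j v)) :
    HasDDifferenceKernel l d S s where
  memLp i j := (hs i j).restrict _
  absCont f := absolutelyContinuousOnInterval_of_eq_integral hl
    (intervalIntegrable_of_L2_Icc (S f) (right_mem_Icc.2 hl)) (integral_kernel_eq hd hs h f)
  hasDeriv f := ae_hasDerivAt_of_eq_integral hl
    (intervalIntegrable_of_L2_Icc (S f) (right_mem_Icc.2 hl)) (integral_kernel_eq hd hs h f)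

/-! ### Self-adjointness. -/

theorem primitive_symm {s s' : ℝ → ℂ} {a b : ℝ} (h : ∀ᵐ v, s v = -(a⁻¹ • b • starRingEnd ℂ (s' (-v))))
    (u : ℝ) : ∫ v in (0 : ℝ)..u, s v = a⁻¹ • b • starRingEnd ℂ (∫ v in (0 : ℝ)..(-u), s' v) := by
  rw [intervalIntegral.integral_congr_ae (h.mono fun v hv _ => hv), intervalIntegral.integral_neg,
    intervalIntegral.integral_smul, intervalIntegral.integral_smul,
    intervalIntegral.integral_comp_neg (fun v => starRingEnd ℂ (s' v)), intervalIntegral_conj,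
    neg_zero, intervalIntegral.integral_symm 0 (-u), smul_neg, smul_neg, neg_neg]

theorem eq_adjoint_of_matrixElement {d : Fin p → ℝ} (hd : ∀ i, 0 < d i)
    {s : Fin p → Fin p → ℝ → ℂ} {S : L2 p l →L[ℂ] L2 p l}
    (hsymm : ∀ i j, ∀ᵐ v, s i j v = -((d i)⁻¹ • d j • starRingEnd ℂ (s j i (-v))))
    (h : ∀ i j, ∀ x ∈ Icc (0 : ℝ) l, ∀ y ∈ Icc (0 : ℝ) l,
      inner ℂ (stepFun l x i) (S (stepFun l y j)) = (d j)⁻¹ •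
      ((∫ v in (0 : ℝ)..(d i * x), s i j v) - (∫ v in (0 : ℝ)..(d i * x - d j * y), s i j v) +
        ∫ v in (0 : ℝ)..(-(d j * y)), s i j v)) :
    S = ContinuousLinearMap.adjoint S := by
  have key : ∀ i j, ∀ x ∈ Icc (0 : ℝ) l, ∀ y ∈ Icc (0 : ℝ) l,
      inner ℂ (stepFun l x i) (S (stepFun l y j)) =
        (inner ℂ (S (stepFun l x i)) (stepFun l y j) : ℂ) := by
    intro i j x hx y hy
    have hj : (d j : ℂ) ≠ 0 := Complex.ofReal_ne_zero.2 (hd j).ne'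
    rw [← inner_conj_symm (S _), h i j x hx y hy, h j i y hy x hx,
      primitive_symm (hsymm i j), primitive_symm (hsymm i j), primitive_symm (hsymm i j), neg_sub,
      neg_neg]
    simp only [Complex.real_smul, map_mul, map_sub, map_add, Complex.conj_ofReal]
    simp only [Complex.ofReal_inv]
    field_simp
    ring
  -- Totality of step functions is used twice: here to get `S = S*` on step functions, then to pass
  -- to every `f`.
  have hstep : ∀ y ∈ Icc (0 : ℝ) l, ∀ j,
      S (stepFun l y j) = ContinuousLinearMap.adjoint S (stepFun l y j) := by
    intro y hy j
    refine eq_of_inner_stepFun fun x hx i => ?_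
    rw [ContinuousLinearMap.adjoint_inner_right, key i j x hx y hy]
  ext1 f
  refine eq_of_inner_stepFun fun y hy j => ?_
  rw [ContinuousLinearMap.adjoint_inner_right, hstep y hy j,
    ContinuousLinearMap.adjoint_inner_left]

end DDiff

theorem mainTheorem3 {p : ℕ} (l : ℝ) (hl : 0 < l) (d : Fin p → ℝ) (hd : ∀ i, 0 < d i)
    (S : DDiff.L2 p l →L[ℂ] DDiff.L2 p l)
    (Φ Φh : ℝ → Matrix (Fin p) (Fin p) ℂ)
    (hΦ : DDiff.EntriesL2 l Φ) (hΦh : DDiff.EntriesL2 l Φh)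
    (hS : DDiff.OperatorIdentity l d S Φ Φh) :
    ∃ s : Fin p → Fin p → ℝ → ℂ,
      DDiff.HasDDifferenceKernel l d S s ∧
      (∀ᵐ u ∂volume.restrict (Ioo (0 : ℝ) l),
        DDiff.kernel d s u 0 = (DDiff.diagD d)⁻¹ * Φ u) ∧
      (∀ᵐ u ∂volume.restrict (Ioo (0 : ℝ) l),
        DDiff.kernel d s 0 u = -((DDiff.diagD d)⁻¹ * Φh u)) ∧
      ((∀ᵐ t ∂volume.restrict (Ioo (0 : ℝ) l), Φh t = (Φ t)ᴴ) →
        (∀ᵐ z : ℝ × ℝ ∂volume.restrict (Ioo (0 : ℝ) l ×ˢ Ioo (0 : ℝ) l),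
          DDiff.kernel d s z.1 z.2 =
            -((DDiff.diagD d)⁻¹ * (DDiff.kernel d s z.2 z.1)ᴴ * DDiff.diagD d)) ∧
        S = ContinuousLinearMap.adjoint S) := by
  have hs := DDiff.memLp_kernelFun hd hΦ hΦh
  have hM : ∀ i j, ∀ x ∈ Icc (0 : ℝ) l, ∀ y ∈ Icc (0 : ℝ) l, _ := fun i j x hx y hy =>
    hS.matrixElement hl hd hΦ hΦh i j hx hy
  refine ⟨DDiff.kernelFun l d Φ Φh,
    DDiff.hasDDifferenceKernel_of_matrixElement hl.le hd hs hM, ?_, ?_, fun h => ⟨?_, ?_⟩⟩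
  · filter_upwards [ae_restrict_mem measurableSet_Ioo] with u hu
    ext i j
    rw [DDiff.diagD_inv hd, Matrix.diagonal_mul, DDiff.kernel, Matrix.of_apply, mul_zero, sub_zero,
      DDiff.kernelFun_mul hd Φ Φh i j hu, Complex.real_smul, Complex.ofReal_inv]
  · filter_upwards [ae_restrict_mem measurableSet_Ioo] with u hu
    ext i j
    rw [DDiff.diagD_inv hd, Matrix.neg_apply, Matrix.diagonal_mul, DDiff.kernel, Matrix.of_apply,
      mul_zero, zero_sub, DDiff.kernelFun_neg_mul hd Φ Φh i j hu, Complex.real_smul,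
      Complex.ofReal_inv]
  · exact ae_restrict_of_ae (DDiff.kernel_symm hd (DDiff.kernelFun_symm hd h))
  · exact DDiff.eq_adjoint_of_matrixElement hd (DDiff.kernelFun_symm hd h) hM
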